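/- Let $X$ be a (Hausdorff, second countable, finite-dimensional) complex manifold and let $\Omega\subsetneq X$ be a domain (a non-empty connected open subset). Let $k_\Omega$ be the Kobayashi pseudodistance of $\Omega$, and assume that $\Omega$ is complete Kobayashi hyperbolic, i.e. $k_\Omega$ is a distance and $(\Omega,k_\Omega)$ is a complete metric space. *End compactification.* Fix an exhaustion of $\overline\Omega$ (closure in $X$) by compact sets $K_j\subset\operatorname{int}K_{j+1}$ (interior relative to $\overline\Omega$). An end of $\overline\Omega$ is a decreasing sequence $(F_j)$, where $F_j$ is a connected component of $\overline\Omega\setminus K_j$. Let $\overline\Omega^{\rm End}$ be the disjoint union of $\overline\Omega$ and the set of ends, topologized by taking as neighbourhoods of $y\in\overline\Omega$ its neighbourhoods in $\overline\Omega$, and as basic neighbourhoods of an end $(F_j)$ the sets $\widehat F_j$ consisting of the points of $F_j$ and the ends that agree with $(F_j)$ up to index $j$ (a set is open if it is a neighbourhood, in this sense, of each of its points). Put $\partial\overline\Omega^{\rm End}=\overline\Omega^{\rm End}\setminus\Omega$, and assume that $\overline\Omega^{\rm End}$ is sequentially compact. *Metric compactification.* Let $C_*(\Omega)$ be the quotient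 of the space $C(\Omega)$ of continuous functions $\Omega\to\mathbb R$ (topology of locally uniform convergence) by the constants, and let $i(z)=[k_\Omega(z,\cdot)]\in C_*(\Omega)$. The metric compactification $\overline\Omega^{k}$ is the closure of $i(\Omega)$ in $C_*(\Omega)$, and the points of $\overline\Omega^{k}\setminus i(\Omega)$ are the metric boundary points. For $p\in\Omega$, $R>0$, a metric boundary point $\xi$ and $x\in\partial\overline\Omega^{\rm End}$, let $h_{p,\xi}$ be the representative of $\xi$ with $h_{p,\xi}(p)=0$ and put $$H_p(\xi,R)=\{z\in\Omega: h_{p,\xi}(z)<\tfrac12\log R\},$$ $$H^b_p(x,R)=\Big\{z\in\Omega:\liminf_{\Omega\ni w\to x}\big(k_\Omega(z,w)-k_\Omega(p,w)\big)<\tfrac12\log R\Big\},$$ $$H^s_p(x,R)=\Big\{z\in\Omega:\limsup_{\Omega\ni w\to x}\big(k_\Omega(z,w)-k_\Omega(p,w)\big)<\tfrac12\log R\Big\}.$$ Let $\mathscr H(x)$ be the set of metric boundary points $\xi$ for which there is a sequence $(x_n)$ in $\Omega$ with $x_n\to x$ in $\overline\Omega^{\rm End}$ and $i(x_n)\to\xi$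 in $\overline\Omega^{k}$. **Theorem.** Suppose in addition that $$\lim_{(z,w)\to(x,y)}k_\Omega(z,w)=\infty\qquad\text{for all } x\neq y \text{ in } \partial\Omega,$$ where $\partial\Omega$ is the boundary of $\Omega$ in $X$. Let $f:\Omega\to\Omega$ be a holomorphic map whose sequence of iterates $(f^n)_{n\ge1}$ is compactly divergent (for all compact $A,B\subset\Omega$ one has $f^n(A)\cap B=\emptyset$ for all large $n$), and let $p\in\Omega$. Then there exist $x\in\partial\overline\Omega^{\rm End}$ and $\xi\in\mathscr H(x)$ such that, for every $n\in\mathbb N$ and every $R>0$, $$f^n(H_p(\xi,R))\subset H^b_p(x,R).$$ In particular, for every $n\in\mathbb N$ and every $R>0$, $$f^n(H^s_p(x,R))\subset H^b_p(x,R).$$ -/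

import Mathlib

open Set Filter Topology TopologicalSpace
open scoped Manifold ContDiff

noncomputable section

/-! ### Metric compactification of a metric space -/

namespace MetricCompactification

/-- The subspace of constant functions in `C(X)`. -/
def constants (X : Type*) [TopologicalSpace X] : AddSubgroup C(X, ℝ) where
  carrier := {f | ∃ c : ℝ, f = ContinuousMap.const X c}
  zero_mem' := ⟨0, rfl⟩
  add_mem' := by
    rintro _ _ ⟨a, rfl⟩ ⟨b, rfl⟩
    exact ⟨a + b, rfl⟩
  neg_mem' := by
    rintro _ ⟨a, rfl⟩
    exact ⟨-a, rfl⟩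

/-- `C_*(X)`: the quotient of `C(X)` (compact-open topology, i.e. local uniform convergence for
locally compact `X`) by the constants, with the quotient topology. -/
abbrev CStar (X : Type*) [TopologicalSpace X] : Type _ := C(X, ℝ) ⧸ constants X

variable {X : Type*} [PseudoMetricSpace X]

/-- The canonical map `x ↦ [d(x, ·)]`. -/
def emb (x : X) : CStar X :=
  QuotientAddGroup.mk (⟨fun z => dist x z, by fun_prop⟩ : C(X, ℝ))

variable (X) in
/-- The metric compactification: the closure of the image of `X` in `C_*(X)`. -/
def compactification : Set (CStar X) := closure (range (emb (X := X)))

variable (X) in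
/-- The metric boundary. -/
def boundary : Set (CStar X) := compactification X \ range (emb (X := X))

/-- The unique representative of a class in `C_*(X)` that vanishes at `p`. -/
def horofunction (p : X) (ξ : CStar X) : X → ℝ :=
  Quotient.liftOn' ξ (fun h z => h z - h p) (by
    intro a b hab
    obtain ⟨c, hc⟩ := QuotientAddGroup.leftRel_apply.mp hab
    funext z
    have h1 := DFunLike.congr_fun hc z
    have h2 := DFunLike.congr_fun hc p
    simp only [ContinuousMap.add_apply, ContinuousMap.neg_apply,
      ContinuousMap.const_apply] at h1 h2
    linarith)

/-- The horoball with pole `p`, center `ξ` and radius `R`. -/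
def horoball (p : X) (ξ : CStar X) (R : ℝ) : Set X :=
  {z | horofunction p ξ z < 1 / 2 * Real.log R}

end MetricCompactification

/-! ### End compactification of a space with a compact exhaustion -/

/-- An end: a decreasing sequence of connected components of the complements of the `K j`. -/
structure SpaceEnd {C : Type*} [TopologicalSpace C] (K : CompactExhaustion C) where
  comp : ℕ → Set C
  isComponent : ∀ j, ∃ y ∈ (K j)ᶜ, comp j = connectedComponentIn (K j)ᶜ y
  decreasing : ∀ j, comp (j + 1) ⊆ comp j

/-- The disjoint union of the space and its set of ends. -/
inductive EndCompactification {C : Type*} [TopologicalSpace C] (K : CompactExhaustion C) where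
  | pt (y : C) : EndCompactification K
  | atEnd (e : SpaceEnd K) : EndCompactification K

namespace EndCompactification

variable {C : Type*} [TopologicalSpace C] {K : CompactExhaustion C}

/-- The basic neighbourhood of the end `e = (F_j)`: the points of `F_j` and the ends that agree
with `e` up to index `j`. -/
def basicNhd (e : SpaceEnd K) (j : ℕ) : Set (EndCompactification K) :=
  pt '' (e.comp j) ∪ atEnd '' {e' | ∀ i ≤ j, e'.comp i = e.comp i}

/-- The prescribed neighbourhood systems. -/
def nhdSystem : EndCompactification K → Filter (EndCompactification K)
  | pt y => map pt (𝓝 y)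
  | atEnd e => ⨅ j, 𝓟 (basicNhd e j)

/-- A set is open iff it belongs to the prescribed neighbourhood system of each of its points. -/
instance : TopologicalSpace (EndCompactification K) := TopologicalSpace.mkOfNhds nhdSystem

end EndCompactification

/-! ### Kobayashi distance -/

/-- The Poincaré distance on the unit disc, with `d(0, ζ) = ½ log ((1 + |ζ|) / (1 - |ζ|))`. -/
def poincareDist (a b : ℂ) : ℝ :=
  Real.artanh ‖(a - b) / (1 - (starRingEnd ℂ) b * a)‖

section Kobayashi

variable (E : Type*) [NormedAddCommGroup E] [NormedSpace ℂ E]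
  {M : Type*} [TopologicalSpace M] [ChartedSpace E M]

/-- `DiscChain E z w ℓ`: there is a finite chain of holomorphic discs joining `z` to `w`, with
total Poincaré length `ℓ`. Discs are maps `ℂ → M` holomorphic on the unit disc; their values
elsewhere play no role. -/
inductive DiscChain : M → M → ℝ → Prop
  | nil (z : M) : DiscChain z z 0
  | cons (φ : ℂ → M) (hφ : MDifferentiableOn 𝓘(ℂ, ℂ) 𝓘(ℂ, E) φ (Metric.ball 0 1))
      (a b : ℂ) (ha : a ∈ Metric.ball (0 : ℂ) 1) (hb : b ∈ Metric.ball (0 : ℂ) 1)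
      (w : M) (l : ℝ) (h : DiscChain (φ b) w l) : DiscChain (φ a) w (poincareDist a b + l)

/-- The Kobayashi (pseudo)distance of a connected complex manifold: the infimum of the lengths of
chains of holomorphic discs joining the two points. -/
def kobayashiDist (z w : M) : ℝ := sInf {l | DiscChain E z w l}

variable {E}

theorem poincareDist_comm (a b : ℂ) : poincareDist a b = poincareDist b a := by
  have h : ‖1 - (starRingEnd ℂ) b * a‖ = ‖1 - (starRingEnd ℂ) a * b‖ := by
    rw [← Complex.norm_conj (1 - (starRingEnd ℂ) b * a)]
    simp [mul_comm]
  unfold poincareDist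
  rw [norm_div, norm_div, h, norm_sub_rev]

theorem poincareDist_nonneg (a b : ℂ) : 0 ≤ poincareDist a b := by
  unfold poincareDist Real.artanh
  set t := ‖(a - b) / (1 - (starRingEnd ℂ) b * a)‖ with ht
  have h0 : 0 ≤ t := norm_nonneg _
  rcases lt_trichotomy t 1 with h | h | h
  · apply Real.log_nonneg
    rw [Real.one_le_sqrt, le_div_iff₀ (by linarith)]
    linarith
  · simp [h]
  · rw [Real.sqrt_eq_zero_of_nonpos (div_nonpos_of_nonneg_of_nonpos (by linarith) (by linarith)),
      Real.log_zero]

theorem DiscChain.nonneg {z w : M} {l : ℝ} (h : DiscChain E z w l) : 0 ≤ l := by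
  induction h with
  | nil z => exact le_rfl
  | cons φ hφ a b ha hb w l h ih => exact add_nonneg (poincareDist_nonneg a b) ih

theorem DiscChain.trans {x y z : M} {l m : ℝ} (h : DiscChain E x y l) (h' : DiscChain E y z m) :
    DiscChain E x z (l + m) := by
  induction h with
  | nil => simpa using h'
  | cons φ hφ a b ha hb w l h ih =>
    rw [add_assoc]
    exact .cons φ hφ a b ha hb _ _ (ih h')

theorem DiscChain.single (φ : ℂ → M)
    (hφ : MDifferentiableOn 𝓘(ℂ, ℂ) 𝓘(ℂ, E) φ (Metric.ball 0 1))
    {a b : ℂ} (ha : a ∈ Metric.ball (0 : ℂ) 1) (hb : b ∈ Metric.ball (0 : ℂ) 1) :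
    DiscChain E (φ a) (φ b) (poincareDist a b) := by
  simpa using DiscChain.cons φ hφ a b ha hb _ _ (.nil (φ b))

theorem DiscChain.symm {x y : M} {l : ℝ} (h : DiscChain E x y l) : DiscChain E y x l := by
  induction h with
  | nil z => exact .nil z
  | cons φ hφ a b ha hb w l h ih =>
    rw [add_comm, poincareDist_comm]
    exact ih.trans (.single φ hφ hb ha)

theorem DiscChain.eventually_exists [IsManifold 𝓘(ℂ, E) ω M] (m : M) :
    ∀ᶠ w in 𝓝 m, ∃ l, DiscChain E m w l := by
  have hop : IsOpen (chartAt E m).target := (chartAt E m).open_target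
  have hm : chartAt E m m ∈ (chartAt E m).target := mem_chart_target E m
  obtain ⟨r, hr, hball⟩ := Metric.isOpen_iff.mp hop _ hm
  have hcont : ContinuousAt (chartAt E m) m := (chartAt E m).continuousAt (mem_chart_source E m)
  filter_upwards [hcont.preimage_mem_nhds (Metric.ball_mem_nhds _ hr),
    (chartAt E m).open_source.mem_nhds (mem_chart_source E m)] with w hw hws
  set v : E := chartAt E m w - chartAt E m m with hv
  have hvr : ‖v‖ < r := by
    have : chartAt E m w ∈ Metric.ball (chartAt E m m) r := hw
    rwa [Metric.mem_ball, dist_eq_norm] at this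
  obtain ⟨t, ht1, ht2⟩ := exists_between ((div_lt_one hr).mpr hvr)
  have ht0 : 0 < t := lt_of_le_of_lt (by positivity) ht1
  have hvt : ‖v‖ < t * r := (div_lt_iff₀ hr).mp ht1
  let g : ℂ → E := fun ζ => chartAt E m m + (ζ / (t : ℂ)) • v
  let φ : ℂ → M := fun ζ => (chartAt E m).symm (g ζ)
  have hmaps : MapsTo g (Metric.ball 0 1) (chartAt E m).target := by
    intro ζ hζ
    apply hball
    have hζ' : ‖ζ‖ < 1 := by simpa using hζ
    have h1 : ‖ζ‖ * ‖v‖ < t * r :=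
      lt_of_le_of_lt (mul_le_of_le_one_left (norm_nonneg _) hζ'.le) hvt
    simp only [g, Metric.mem_ball, dist_eq_norm, add_sub_cancel_left, norm_smul, norm_div,
      Complex.norm_real, Real.norm_eq_abs, abs_of_pos ht0]
    rw [div_mul_eq_mul_div, div_lt_iff₀ ht0]
    linarith
  have hg : Differentiable ℂ g := by
    intro ζ
    simp only [g]
    fun_prop
  have hφ : MDifferentiableOn 𝓘(ℂ, ℂ) 𝓘(ℂ, E) φ (Metric.ball 0 1) := by
    have h1 : MDifferentiableOn 𝓘(ℂ, E) 𝓘(ℂ, E) (chartAt E m).symm (chartAt E m).target :=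
      (contMDiffOn_chart_symm (I := 𝓘(ℂ, E)) (n := ω) (x := m)).mdifferentiableOn (by simp)
    exact h1.comp hg.mdifferentiable.mdifferentiableOn hmaps
  have h0 : φ 0 = m := by
    simp [φ, g, (chartAt E m).left_inv (mem_chart_source E m)]
  have h1 : φ (t : ℂ) = w := by
    have : (t : ℂ) ≠ 0 := by exact_mod_cast ht0.ne'
    simp [φ, g, this, hv, (chartAt E m).left_inv hws]
  have := DiscChain.single φ hφ (a := 0) (b := (t : ℂ)) (by simp)
    (by simpa [abs_of_pos ht0] using ht2)
  rw [h0, h1] at this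
  exact ⟨_, this⟩

theorem DiscChain.exists [IsManifold 𝓘(ℂ, E) ω M] [ConnectedSpace M] (z w : M) :
    ∃ l, DiscChain E z w l := by
  have hcl : IsClopen {w : M | ∃ l, DiscChain E z w l} := by
    constructor
    · rw [← isOpen_compl_iff, isOpen_iff_mem_nhds]
      intro y hy
      filter_upwards [DiscChain.eventually_exists (E := E) y] with u hu ⟨l, hl⟩
      obtain ⟨l', hl'⟩ := hu
      exact hy ⟨_, hl.trans hl'.symm⟩
    · rw [isOpen_iff_mem_nhds]
      rintro y ⟨l, hl⟩
      filter_upwards [DiscChain.eventually_exists (E := E) y] with u hu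
      obtain ⟨l', hl'⟩ := hu
      exact ⟨_, hl.trans hl'⟩
  have hw : w ∈ {w : M | ∃ l, DiscChain E z w l} := by
    rw [hcl.eq_univ ⟨z, 0, .nil z⟩]
    exact mem_univ w
  exact hw

variable (E) in
/-- The set `M`, to be equipped with the Kobayashi distance in place of its manifold topology. -/
def KobayashiSpace (M : Type*) [TopologicalSpace M] [ChartedSpace E M] : Type _ := M

variable (E) in
/-- The identity map from a manifold to itself with the Kobayashi distance. -/
def toKob : M ≃ KobayashiSpace E M := Equiv.refl M

instance [IsManifold 𝓘(ℂ, E) ω M] [ConnectedSpace M] :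
    PseudoMetricSpace (KobayashiSpace E M) where
  dist z w := kobayashiDist E ((toKob E).symm z) ((toKob E).symm w)
  dist_self z := by
    apply le_antisymm
    · exact csInf_le ⟨0, fun l hl => DiscChain.nonneg hl⟩ (.nil _)
    · exact Real.sInf_nonneg fun l hl => DiscChain.nonneg hl
  dist_comm z w := by
    unfold kobayashiDist
    congr 1
    ext l
    exact ⟨DiscChain.symm, DiscChain.symm⟩
  dist_triangle x y z := by
    obtain ⟨l₁, hl₁⟩ := DiscChain.exists (E := E) ((toKob E).symm x) ((toKob E).symm y)
    obtain ⟨l₂, hl₂⟩ := DiscChain.exists (E := E) ((toKob E).symm y) ((toKob E).symm z)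
    refine le_of_forall_pos_lt_add fun ε hε => ?_
    obtain ⟨a, ha, ha'⟩ := Real.lt_sInf_add_pos (s := {l | DiscChain E _ _ l}) ⟨l₁, hl₁⟩
      (half_pos hε)
    obtain ⟨b, hb, hb'⟩ := Real.lt_sInf_add_pos (s := {l | DiscChain E _ _ l}) ⟨l₂, hl₂⟩
      (half_pos hε)
    have h : kobayashiDist E ((toKob E).symm x) ((toKob E).symm z) ≤ a + b :=
      csInf_le ⟨0, fun l hl => DiscChain.nonneg hl⟩
        (DiscChain.trans (E := E) (show DiscChain E _ _ _ from ha) hb)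
    unfold kobayashiDist at h ⊢
    linarith

variable (E M) in
/-- Kobayashi hyperbolicity: the Kobayashi pseudodistance is a distance. -/
def IsKobayashiHyperbolic : Prop := ∀ z w : M, kobayashiDist E z w = 0 → z = w

variable (E M) in
/-- Complete Kobayashi hyperbolicity: the Kobayashi pseudodistance is a distance, and it is
(Cauchy) complete. -/
def IsCompleteKobayashiHyperbolic [IsManifold 𝓘(ℂ, E) ω M] [ConnectedSpace M] : Prop :=
  IsKobayashiHyperbolic E M ∧ CompleteSpace (KobayashiSpace E M)

end Kobayashi

/-- A sequence of self-maps is compactly divergent if for all compact `A`, `B` the image of `A`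
is eventually disjoint from `B`. -/
def CompactlyDivergent {M : Type*} [TopologicalSpace M] (g : ℕ → M → M) : Prop :=
  ∀ A B : Set M, IsCompact A → IsCompact B → ∀ᶠ n in atTop, Disjoint (g n '' A) B

/-! ### Domains in complex manifolds -/

section Domain

variable {X : Type*} [TopologicalSpace X] {Ω : Opens X}

/-- The inclusion of `Ω` in the end compactification of its closure. -/
def toEnd (K : CompactExhaustion (closure (Ω : Set X))) (z : Ω) : EndCompactification K :=
  .pt ⟨z, subset_closure z.2⟩

/-- The boundary of `Ω` in the end compactification of its closure. -/
def endBoundary (K : CompactExhaustion (closure (Ω : Set X))) : Set (EndCompactification K) :=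
  (range (toEnd K))ᶜ

variable (E : Type*) [NormedAddCommGroup E] [NormedSpace ℂ E] [ChartedSpace E X]

/-- The Kobayashi distance `k_Ω(z, w)` tends to infinity as `(z, w)`, with `z, w ∈ Ω`, tends to any
pair of distinct points of the boundary of `Ω` in `X`. -/
def KobayashiDivergesAtBoundary (Ω : Opens X) : Prop :=
  ∀ x ∈ frontier (Ω : Set X), ∀ y ∈ frontier (Ω : Set X), x ≠ y →
    Tendsto (fun q : Ω × Ω => kobayashiDist E q.1 q.2)
      (comap (fun q : Ω × Ω => ((q.1 : X), (q.2 : X))) (𝓝 (x, y))) atTop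

/-- The big horosphere with pole `p`, center `x` and radius `R`. -/
def bigHorosphere (K : CompactExhaustion (closure (Ω : Set X))) (p : Ω)
    (x : EndCompactification K) (R : ℝ) : Set Ω :=
  {z | liminf (fun w : Ω => ((kobayashiDist E z w - kobayashiDist E p w : ℝ) : EReal))
    (comap (toEnd K) (𝓝 x)) < ((1 / 2 * Real.log R : ℝ) : EReal)}

/-- The small horosphere with pole `p`, center `x` and radius `R`. -/
def smallHorosphere (K : CompactExhaustion (closure (Ω : Set X))) (p : Ω)
    (x : EndCompactification K) (R : ℝ) : Set Ω :=
  {z | limsup (fun w : Ω => ((kobayashiDist E z w - kobayashiDist E p w : ℝ) : EReal))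
    (comap (toEnd K) (𝓝 x)) < ((1 / 2 * Real.log R : ℝ) : EReal)}

variable [IsManifold 𝓘(ℂ, E) ω X] [ConnectedSpace Ω]

/-- The horoball of `(Ω, k_Ω)` with pole `p`, center `ξ` and radius `R`. -/
def kobayashiHoroball (p : Ω) (ξ : MetricCompactification.CStar (KobayashiSpace E Ω)) (R : ℝ) :
    Set Ω :=
  toKob E ⁻¹' MetricCompactification.horoball (toKob E p) ξ R

/-- The set `𝓗(x)` of metric boundary points of `(Ω, k_Ω)` that are limits of a sequence of points
of `Ω` converging to `x` in the end compactification. -/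
def metricFiber (K : CompactExhaustion (closure (Ω : Set X))) (x : EndCompactification K) :
    Set (MetricCompactification.CStar (KobayashiSpace E Ω)) :=
  {ξ ∈ MetricCompactification.boundary (KobayashiSpace E Ω) |
    ∃ u : ℕ → Ω, Tendsto (fun n => toEnd K (u n)) atTop (𝓝 x) ∧
      Tendsto (fun n => MetricCompactification.emb (toKob E (u n))) atTop (𝓝 ξ)}

end Domain

end

/-! The orbit of `p` escapes: completeness makes closed Kobayashi balls compact, so compact
divergence gives k(p, fⁿ(p)) → ∞. A real sequence tending to infinity has infinitely many times m
with k(p, fᵐ(p)) ≤ k(p, fᵐ⁺ʲ(p)) for all j (`exists_strictMono_forall_le_add`). Along such times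
choose a subsequence u of the orbit tending to a point x of the end compactification and to a metric
boundary point ξ.

Fix j. Since fʲ does not increase k and u is taken at those times, k(fʲ(z), fʲ(u)) - k(p, fʲ(u)) ≤
k(z, u) - k(p, u), and the right side tends to the horofunction of ξ at z. If fʲ(u) also tends to x,
the liminf defining the big horosphere at fʲ(z) is at most that value, which is the first inclusion.
The second follows because the horofunction is at most the limsup at x.

That fʲ(u) tends to x is where the boundary hypothesis enters: fʲ(u) stays within k(p, fʲ(p)) of u,
and `tendsto_toEnd_of_kobayashiDist_le` shows that sequences at bounded distance share their limit.
Otherwise chains of discs joining them would cross fixed compact frontiers and produce two distinct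
boundary points approached at bounded distance.

The metric input is that k is an inner distance inducing the manifold topology: Hopf–Rinow gives
properness, Arzelà–Ascoli gives ξ, and approximate intermediate points show that ξ is not an
interior point. -/

/-! ### Proper metric spaces -/

section LengthSpace

variable {Y : Type*} [PseudoMetricSpace Y]

/-- Approximate intermediate points: for `0 ≤ s ≤ l` and `dist x y < l` there is a point at distance
at most `s` from `x` and at most `l - s` from `y`. -/
def HasApproxIntermediatePoints (Y : Type*) [PseudoMetricSpace Y] : Prop :=
  ∀ (x y : Y) (l s : ℝ), dist x y < l → 0 ≤ s → s ≤ l → ∃ z, dist x z ≤ s ∧ dist z y ≤ l - s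

/-- The Hopf–Rinow theorem: a complete locally compact space with approximate intermediate points
is proper. -/
theorem HasApproxIntermediatePoints.properSpace [CompleteSpace Y] [LocallyCompactSpace Y]
    (hY : HasApproxIntermediatePoints Y) : ProperSpace Y := by
  refine ⟨fun x => ?_⟩
  have hmono : ∀ r s : ℝ, r ≤ s → IsCompact (Metric.closedBall x s) →
      IsCompact (Metric.closedBall x r) := fun r s hrs hs =>
    hs.of_isClosed_subset Metric.isClosed_closedBall (Metric.closedBall_subset_closedBall hrs)
  by_contra! hcon
  obtain ⟨r₀, hr₀⟩ := hcon
  set I : Set ℝ := {r | IsCompact (Metric.closedBall x r)} with hI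
  have hbdd : BddAbove I := ⟨r₀, fun r hr => by
    by_contra! h
    exact hr₀ (hmono _ _ h.le hr)⟩
  obtain ⟨δ₀, hδ₀, hδ₀c⟩ := (isCompact_singleton (x := x)).exists_isCompact_cthickening
  rw [Metric.cthickening_singleton _ hδ₀.le] at hδ₀c
  have hne : I.Nonempty := ⟨δ₀, hδ₀c⟩
  set R := sSup I with hR
  have hRpos : 0 < R := hδ₀.trans_le (le_csSup hbdd hδ₀c)
  -- Every point of this ball is within ε/2 of a compact ball of radius slightly below R. The `max`
  -- with 0 keeps that radius admissible as an intermediate distance.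
  have hRc : IsCompact (Metric.closedBall x R) := by
    refine isCompact_iff_totallyBounded_isComplete.mpr
      ⟨?_, Metric.isClosed_closedBall.isComplete⟩
    rw [Metric.totallyBounded_iff]
    intro ε hε
    obtain ⟨r, hrI, hr⟩ := exists_lt_of_lt_csSup hne
      (show max (R - ε / 4) 0 < R from max_lt (by linarith) hRpos)
    have hsc : IsCompact (Metric.closedBall x (max (R - ε / 4) 0)) := hmono _ _ hr.le hrI
    obtain ⟨t, htf, ht⟩ := Metric.totallyBounded_iff.mp hsc.totallyBounded (ε / 4) (by linarith)
    refine ⟨t, htf, fun y hy => ?_⟩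
    rw [Metric.mem_closedBall, dist_comm] at hy
    obtain ⟨z, hz1, hz2⟩ := hY x y (R + ε / 4) (max (R - ε / 4) 0) (by linarith)
      (le_max_right _ _) (max_le (by linarith) (by linarith))
    have hz : z ∈ Metric.closedBall x (max (R - ε / 4) 0) := by
      rwa [Metric.mem_closedBall, dist_comm]
    obtain ⟨c, hct, hc⟩ := mem_iUnion₂.mp (ht hz)
    refine mem_iUnion₂.mpr ⟨c, hct, ?_⟩
    rw [Metric.mem_ball] at hc ⊢
    have h1 := dist_triangle y z c
    rw [dist_comm y z] at h1
    have h2 := le_max_left (R - ε / 4) 0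
    linarith
  obtain ⟨δ, hδ, hδc⟩ := hRc.exists_isCompact_cthickening
  have hsub : Metric.closedBall x (R + δ / 2) ⊆ Metric.cthickening δ (Metric.closedBall x R) := by
    intro y hy
    rw [Metric.mem_closedBall, dist_comm] at hy
    obtain ⟨z, hz1, hz2⟩ := hY x y (R + δ) R (by linarith) hRpos.le (by linarith)
    refine Metric.mem_cthickening_of_dist_le y z δ _ (by rwa [Metric.mem_closedBall, dist_comm]) ?_
    rw [dist_comm]
    linarith
  have hmem : R + δ / 2 ∈ I := hδc.of_isClosed_subset Metric.isClosed_closedBall hsub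
  have := le_csSup hbdd hmem
  linarith

end LengthSpace

/-! ### Normalized distance functions and metric boundary points -/

namespace MetricCompactification

variable {Y : Type*} [PseudoMetricSpace Y]

/-- The representative of `emb x` that vanishes at `p`. -/
def normalizedDist (p x : Y) : C(Y, ℝ) := ⟨fun z => dist x z - dist x p, by fun_prop⟩

theorem mk_normalizedDist (p x : Y) :
    (QuotientAddGroup.mk (normalizedDist p x) : CStar Y) = emb x := by
  refine QuotientAddGroup.eq.mpr ⟨dist x p, ?_⟩
  ext z
  simp [normalizedDist]

/-- Arzelà–Ascoli: a 1-Lipschitz function vanishing at `p` takes values in [-d(y, p), d(y, p)] at y,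
and the conditions are closed under pointwise limits. -/
theorem isCompact_lipschitz_normalized (p : Y) :
    IsCompact {h : C(Y, ℝ) | h p = 0 ∧ LipschitzWith 1 h} := by
  refine ArzelaAscoli.isCompact_of_equicontinuous _ ?_ ?_
  · have heq : ContinuousMap.toFun '' {h : C(Y, ℝ) | h p = 0 ∧ LipschitzWith 1 h} =
        {g : Y → ℝ | g p = 0 ∧ ∀ y z, dist (g y) (g z) ≤ dist y z} := by
      ext g
      constructor
      · rintro ⟨h, ⟨h0, hl⟩, rfl⟩
        exact ⟨h0, fun y z => by simpa using hl.dist_le_mul y z⟩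
      · rintro ⟨h0, hl⟩
        have hl' : LipschitzWith 1 g := LipschitzWith.of_dist_le_mul (by simpa using hl)
        exact ⟨⟨g, hl'.continuous⟩, ⟨h0, hl'⟩, rfl⟩
    rw [heq]
    refine (isCompact_univ_pi fun y => isCompact_closedBall (0 : ℝ) (dist y p)).of_isClosed_subset
      ?_ ?_
    · have hset : {g : Y → ℝ | g p = 0 ∧ ∀ y z, dist (g y) (g z) ≤ dist y z} =
          {g | g p = 0} ∩ ⋂ y, ⋂ z, {g | dist (g y) (g z) ≤ dist y z} := by
        ext g
        simp
      rw [hset]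
      exact (isClosed_eq (continuous_apply p) continuous_const).inter <|
        isClosed_iInter fun y => isClosed_iInter fun z =>
          isClosed_le ((continuous_apply y).dist (continuous_apply z)) continuous_const
    · rintro g ⟨h0, hl⟩ y -
      have := hl y p
      rwa [h0] at this
  · refine Metric.equicontinuous_of_continuity_modulus id tendsto_id _ ?_
    rintro x y ⟨h, -, hl⟩
    simpa using hl.dist_le_mul x y

/-- If h were d(q, ·) + c, it would be minimal at q; but moving from q towards a far `u n` lowers
the distance to `u n` by a definite amount, which survives in the limit. -/
theorem mk_mem_boundary [ProperSpace Y] (hY : HasApproxIntermediatePoints Y) {p : Y} {u : ℕ → Y}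
    (hu : Tendsto (fun n => dist p (u n)) atTop atTop) {h : C(Y, ℝ)}
    (hlim : Tendsto (fun n => normalizedDist p (u n)) atTop (𝓝 h)) :
    (QuotientAddGroup.mk h : CStar Y) ∈ boundary Y := by
  constructor
  · refine mem_closure_of_tendsto
      ((QuotientAddGroup.continuous_mk (N := constants Y)).continuousAt.tendsto.comp hlim)
      (Eventually.of_forall fun n => ⟨u n, ?_⟩)
    exact (mk_normalizedDist p (u n)).symm
  · rintro ⟨q, hq⟩
    obtain ⟨c, hc⟩ := QuotientAddGroup.eq.mp hq
    have hval : ∀ z, h z = dist q z + c := fun z => by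
      have := DFunLike.congr_fun hc z
      simp only [ContinuousMap.add_apply, ContinuousMap.neg_apply, ContinuousMap.const_apply,
        ContinuousMap.coe_mk] at this
      linarith
    have hunif := Metric.tendstoUniformlyOn_iff.mp
      (ContinuousMap.tendsto_iff_forall_isCompact_tendstoUniformlyOn.mp hlim _
        (isCompact_closedBall q 1)) (1 / 8) (by norm_num)
    obtain ⟨n, hn, hfar⟩ := (hunif.and (hu.eventually_ge_atTop (dist p q + 1))).exists
    have htri := dist_triangle p q (u n)
    -- The point z is nearer to `u n` than q by at least 1/2, while the two approximation errors
    -- total less than 1/4.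
    obtain ⟨z, hz1, hz2⟩ := hY q (u n) (dist q (u n) + 1 / 2) 1 (by linarith) zero_le_one
      (by linarith)
    have h1 := hn z (by rwa [Metric.mem_closedBall, dist_comm])
    have h2 := hn q (by simp)
    simp only [normalizedDist, ContinuousMap.coe_mk, Real.dist_eq, hval, dist_self,
      dist_comm (u n), abs_lt] at h1 h2
    have h3 := dist_nonneg (x := q) (y := z)
    linarith [h1.1, h1.2, h2.1, h2.2]

/-- A sequence tending to infinity in a proper inner metric space has a subsequence converging to
a metric boundary point. -/
theorem exists_subseq_tendsto_boundary [ProperSpace Y] (hY : HasApproxIntermediatePoints Y)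
    {p : Y} {u : ℕ → Y} (hu : Tendsto (fun n => dist p (u n)) atTop atTop) :
    ∃ ξ ∈ boundary Y, ∃ φ : ℕ → ℕ, StrictMono φ ∧
      Tendsto (fun n => emb (u (φ n))) atTop (𝓝 ξ) ∧
      ∀ z, Tendsto (fun n => dist (u (φ n)) z - dist (u (φ n)) p) atTop
        (𝓝 (horofunction p ξ z)) := by
  have hmem : ∀ n, normalizedDist p (u n) ∈ {h : C(Y, ℝ) | h p = 0 ∧ LipschitzWith 1 h} := by
    intro n
    refine ⟨by simp [normalizedDist], LipschitzWith.of_dist_le_mul fun y z => ?_⟩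
    simp only [normalizedDist, ContinuousMap.coe_mk, Real.dist_eq, NNReal.coe_one, one_mul,
      sub_sub_sub_cancel_right]
    rw [dist_comm (u n) y, dist_comm (u n) z]
    exact abs_dist_sub_le y z (u n)
  obtain ⟨h, ⟨h0, -⟩, φ, hφ, hlim⟩ := (isCompact_lipschitz_normalized p).tendsto_subseq hmem
  refine ⟨QuotientAddGroup.mk h, mk_mem_boundary hY (hu.comp hφ.tendsto_atTop) hlim, φ, hφ, ?_, ?_⟩
  · have := (QuotientAddGroup.continuous_mk (N := constants Y)).continuousAt.tendsto.comp hlim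
    refine this.congr fun n => ?_
    exact mk_normalizedDist p (u (φ n))
  · intro z
    have hz : horofunction p (QuotientAddGroup.mk h) z = h z := by
      change h z - h p = h z
      rw [h0, sub_zero]
    rw [hz]
    exact (continuous_eval_const z).continuousAt.tendsto.comp hlim

end MetricCompactification

/-! ### The Poincaré distance along a radius -/

theorem poincareDist_zero_left (b : ℂ) : poincareDist 0 b = Real.artanh ‖b‖ := by
  simp [poincareDist]

theorem poincareDist_ofReal_eq_sub {τ t : ℝ} (h0 : 0 ≤ τ) (hτ : τ ≤ t) (ht : t < 1) :
    poincareDist (τ : ℂ) (t : ℂ) = Real.artanh t - Real.artanh τ := by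
  have hden : 0 < 1 - t * τ := by nlinarith
  have hq : (((τ : ℂ) - t) / (1 - (starRingEnd ℂ) (t : ℂ) * τ)) =
      (((τ - t) / (1 - t * τ) : ℝ) : ℂ) := by
    simp
  have hnorm : ‖((τ : ℂ) - t) / (1 - (starRingEnd ℂ) (t : ℂ) * τ)‖ = (t - τ) / (1 - t * τ) := by
    rw [hq, Complex.norm_real, Real.norm_eq_abs, abs_div, abs_of_pos hden, abs_of_nonpos
      (by linarith), neg_sub]
  have hlt : (t - τ) / (1 - t * τ) < 1 := by
    rw [div_lt_one hden]
    nlinarith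
  have hge : 0 ≤ (t - τ) / (1 - t * τ) := div_nonneg (by linarith) hden.le
  unfold poincareDist
  rw [hnorm, Real.artanh_eq_half_log ⟨by linarith, hlt.le⟩,
    Real.artanh_eq_half_log (x := t) ⟨by linarith, ht.le⟩,
    Real.artanh_eq_half_log (x := τ) ⟨by linarith, by linarith⟩, ← mul_sub,
    ← Real.log_div (by apply ne_of_gt; apply div_pos <;> linarith)
      (by apply ne_of_gt; apply div_pos <;> linarith)]
  congr 2
  have h1 : 1 - t ≠ 0 := by linarith
  have h2 : 1 - τ ≠ 0 := by linarith
  have h3 : 1 + τ ≠ 0 := by linarith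
  have h4 : 1 - t * τ ≠ 0 := hden.ne'
  have h5 : 1 - (t - τ) / (1 - t * τ) ≠ 0 := by linarith
  have h6 : (1 - t * τ) - (t - τ) ≠ 0 := by nlinarith
  rw [show 1 - (t - τ) / (1 - t * τ) = ((1 - t * τ) - (t - τ)) / (1 - t * τ) by field_simp,
    show 1 + (t - τ) / (1 - t * τ) = ((1 - t * τ) + (t - τ)) / (1 - t * τ) by field_simp,
    div_div_div_cancel_right₀ h4, div_div_div_eq, div_eq_div_iff h6 (by positivity)]
  ring

theorem one_sub_conj_mul_ne_zero {a z : ℂ} (ha : ‖a‖ < 1) (hz : ‖z‖ < 1) :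
    1 - (starRingEnd ℂ) a * z ≠ 0 := by
  intro h
  have h1 : ‖(starRingEnd ℂ) a * z‖ = 1 := by rw [← sub_eq_zero.mp h, norm_one]
  rw [norm_mul, Complex.norm_conj] at h1
  nlinarith [norm_nonneg a, norm_nonneg z]

theorem norm_mobius_lt_one {a z : ℂ} (ha : ‖a‖ < 1) (hz : ‖z‖ < 1) :
    ‖(z - a) / (1 - (starRingEnd ℂ) a * z)‖ < 1 := by
  have hne := one_sub_conj_mul_ne_zero ha hz
  rw [norm_div, div_lt_one (norm_pos_iff.mpr hne)]
  refine lt_of_pow_lt_pow_left₀ 2 (norm_nonneg _) ?_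
  have key : ‖1 - (starRingEnd ℂ) a * z‖ ^ 2 - ‖z - a‖ ^ 2 = (1 - ‖a‖ ^ 2) * (1 - ‖z‖ ^ 2) := by
    simp only [Complex.sq_norm, Complex.normSq_apply, Complex.sub_re, Complex.sub_im,
      Complex.mul_re, Complex.mul_im, Complex.conj_re, Complex.conj_im, Complex.one_re,
      Complex.one_im]
    ring
  have h1 : 0 < 1 - ‖a‖ ^ 2 := by nlinarith [norm_nonneg a]
  have h2 : 0 < 1 - ‖z‖ ^ 2 := by nlinarith [norm_nonneg z]
  nlinarith [mul_pos h1 h2]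

/-- Otherwise the interior of `T` and the exterior of `T` would separate `S`. This turns a chain
leaving a compact set into a point on its compact frontier. -/
theorem IsPreconnected.exists_mem_frontier {Y : Type*} [TopologicalSpace Y] {S T : Set Y}
    (hS : IsPreconnected S) (h1 : (S ∩ T).Nonempty) (h2 : (S ∩ Tᶜ).Nonempty) :
    ∃ s ∈ S, s ∈ frontier T := by
  by_contra! hcon
  have hcover : S ⊆ interior T ∪ (closure T)ᶜ := by
    intro s hs
    by_contra hs'
    rw [mem_union, not_or, notMem_compl_iff] at hs'
    exact hcon s hs ⟨hs'.2, hs'.1⟩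
  obtain ⟨a, haS, haT⟩ := h1
  obtain ⟨b, hbS, hbT⟩ := h2
  have ha : a ∈ interior T := (hcover haS).resolve_right fun h => h (subset_closure haT)
  have hb : b ∈ (closure T)ᶜ := (hcover hbS).resolve_left fun h => hbT (interior_subset h)
  obtain ⟨c, -, hc1, hc2⟩ := hS _ _ isOpen_interior isClosed_closure.isOpen_compl hcover
    ⟨a, haS, ha⟩ ⟨b, hbS, hb⟩
  exact hc2 (subset_closure (interior_subset hc1))

/-! ### Cutting chains of discs, and the topology of the Kobayashi distance -/

section Kobayashi

variable {E : Type*} [NormedAddCommGroup E] [NormedSpace ℂ E]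
  {M : Type*} [TopologicalSpace M] [ChartedSpace E M]

/-- Two points of a holomorphic disc lie on the image of a radius, at the same distance. -/
theorem exists_radial_disc {φ : ℂ → M}
    (hφ : MDifferentiableOn 𝓘(ℂ, ℂ) 𝓘(ℂ, E) φ (Metric.ball 0 1)) {a b : ℂ}
    (ha : a ∈ Metric.ball (0 : ℂ) 1) (hb : b ∈ Metric.ball (0 : ℂ) 1) :
    ∃ (ψ : ℂ → M) (t : ℝ), MDifferentiableOn 𝓘(ℂ, ℂ) 𝓘(ℂ, E) ψ (Metric.ball 0 1) ∧
      0 ≤ t ∧ t < 1 ∧ ψ 0 = φ a ∧ ψ t = φ b ∧ Real.artanh t = poincareDist a b := by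
  have ha' : ‖a‖ < 1 := by simpa using ha
  have hb' : ‖b‖ < 1 := by simpa using hb
  set c : ℂ := (b - a) / (1 - (starRingEnd ℂ) a * b) with hc
  have hc1 : ‖c‖ < 1 := norm_mobius_lt_one ha' hb'
  -- Taking e from the argument of c, not as c / ‖c‖, covers the case c = 0.
  obtain ⟨e, he, hce⟩ : ∃ e : ℂ, ‖e‖ = 1 ∧ (‖c‖ : ℂ) * e = c := by
    refine ⟨Complex.exp (Complex.arg c * Complex.I), Complex.norm_exp_ofReal_mul_I _, ?_⟩
    exact Complex.norm_mul_exp_arg_mul_I c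
  have hza : ‖-a‖ < 1 := by rwa [norm_neg]
  have hmul : ∀ ζ : ℂ, ‖ζ‖ < 1 → ‖ζ * e‖ < 1 := fun ζ hζ => by rwa [norm_mul, he, mul_one]
  -- A rotation followed by the Möbius map inverse to the one defining c: it sends 0 to a and ‖c‖ to
  -- b.
  let g : ℂ → ℂ := fun ζ => (ζ * e - -a) / (1 - (starRingEnd ℂ) (-a) * (ζ * e))
  have hg : DifferentiableOn ℂ g (Metric.ball 0 1) := by
    intro ζ hζ
    have hζ' : ‖ζ‖ < 1 := by simpa using hζ
    refine DifferentiableAt.differentiableWithinAt (DifferentiableAt.div (by fun_prop)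
      (by fun_prop) (one_sub_conj_mul_ne_zero hza (hmul ζ hζ')))
  have hgm : MapsTo g (Metric.ball 0 1) (Metric.ball 0 1) := by
    intro ζ hζ
    have hζ' : ‖ζ‖ < 1 := by simpa using hζ
    exact mem_ball_zero_iff.mpr (norm_mobius_lt_one hza (hmul ζ hζ'))
  refine ⟨φ ∘ g, ‖c‖, hφ.comp hg.mdifferentiableOn hgm, norm_nonneg _, hc1, ?_, ?_, ?_⟩
  · simp [g]
  · simp only [Function.comp_apply]
    congr 1
    simp only [g, hce, sub_neg_eq_add, map_neg, neg_mul]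
    have h1 := one_sub_conj_mul_ne_zero ha' hb'
    have h2 := one_sub_conj_mul_ne_zero hza hc1
    simp only [map_neg, neg_mul, sub_neg_eq_add] at h2
    have h3 : c * (1 - (starRingEnd ℂ) a * b) = b - a := div_mul_cancel₀ _ h1
    rw [div_eq_iff h2]
    linear_combination h3
  · rw [poincareDist_comm]
    rfl

theorem kobayashiDist_le_of_discChain {z w : M} {l : ℝ} (h : DiscChain E z w l) :
    kobayashiDist E z w ≤ l :=
  csInf_le ⟨0, fun _ hl => DiscChain.nonneg hl⟩ h

theorem exists_discChain_lt [IsManifold 𝓘(ℂ, E) ω M] [ConnectedSpace M] {z w : M} {l : ℝ}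
    (h : kobayashiDist E z w < l) : ∃ l' < l, DiscChain E z w l' := by
  obtain ⟨l', hl', hlt⟩ := exists_lt_of_csInf_lt (DiscChain.exists (E := E) z w) h
  exact ⟨l', hlt, hl'⟩

theorem ofReal_mem_ball {t : ℝ} (h0 : 0 ≤ t) (h1 : t < 1) : (t : ℂ) ∈ Metric.ball (0 : ℂ) 1 := by
  simpa [abs_of_nonneg h0] using h1

/-- The points of a chain of radii joining `z` to `w`. -/
theorem DiscChain.exists_isPreconnected {z w : M} {l : ℝ} (h : DiscChain E z w l) :
    ∃ S : Set M, IsPreconnected S ∧ z ∈ S ∧ w ∈ S ∧ ∀ s ∈ S, ∃ l' ≤ l, DiscChain E z s l' := by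
  induction h with
  | nil z =>
    exact ⟨{z}, isPreconnected_singleton, rfl, rfl, by
      rintro s rfl
      exact ⟨0, le_rfl, .nil s⟩⟩
  | cons φ hφ a b ha hb w l h ih =>
    obtain ⟨S, hS, hbS, hwS, hSl⟩ := ih
    obtain ⟨ψ, t, hψ, ht0, ht1, hψ0, hψt, hd⟩ := exists_radial_disc hφ ha hb
    have hsub : (fun τ : ℝ => (τ : ℂ)) '' Icc 0 t ⊆ Metric.ball 0 1 := by
      rintro _ ⟨τ, hτ, rfl⟩
      exact ofReal_mem_ball hτ.1 (hτ.2.trans_lt ht1)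
    -- Only a radius of each disc is kept, since `artanh` increases along it and so bounds the
    -- length to every point; consecutive radii meet at φ b.
    have hT : IsPreconnected (ψ '' ((fun τ : ℝ => (τ : ℂ)) '' Icc 0 t)) :=
      (isPreconnected_Icc.image _ Complex.continuous_ofReal.continuousOn).image _
        (hψ.continuousOn.mono hsub)
    have hzT : φ a ∈ ψ '' ((fun τ : ℝ => (τ : ℂ)) '' Icc 0 t) :=
      ⟨0, ⟨0, ⟨le_rfl, ht0⟩, by simp⟩, hψ0⟩
    have hbT : φ b ∈ ψ '' ((fun τ : ℝ => (τ : ℂ)) '' Icc 0 t) :=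
      ⟨t, ⟨t, ⟨ht0, le_rfl⟩, rfl⟩, hψt⟩
    refine ⟨_, hT.union (φ b) hbT hbS hS, Or.inl hzT, Or.inr hwS, ?_⟩
    rintro s (⟨_, ⟨τ, hτ, rfl⟩, rfl⟩ | hs)
    · refine ⟨Real.artanh τ, ?_, ?_⟩
      · have h1 := Real.artanh_le_artanh (by linarith [hτ.1]) ht1 hτ.2
        linarith [h.nonneg]
      · have := DiscChain.single ψ hψ (a := 0) (by simp)
          (ofReal_mem_ball hτ.1 (hτ.2.trans_lt ht1))
        rwa [hψ0, poincareDist_zero_left, Complex.norm_real, Real.norm_of_nonneg hτ.1] at this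
    · obtain ⟨k, hk, hc⟩ := hSl s hs
      exact ⟨_, by linarith, .cons φ hφ a b ha hb s k hc⟩

/-- A chain of discs can be cut at any length. -/
theorem DiscChain.exists_intermediate {z w : M} {l : ℝ} (h : DiscChain E z w l) :
    ∀ s, 0 ≤ s → s ≤ l → ∃ y, DiscChain E z y s ∧ DiscChain E y w (l - s) := by
  induction h with
  | nil z =>
    intro s h0 h1
    obtain rfl : s = 0 := le_antisymm h1 h0
    exact ⟨z, .nil z, by simpa using DiscChain.nil z⟩
  | cons φ hφ a b ha hb w l h ih =>
    intro s h0 h1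
    rcases le_total s (poincareDist a b) with hs | hs
    · obtain ⟨ψ, t, hψ, ht0, ht1, hψ0, hψt, hd⟩ := exists_radial_disc hφ ha hb
      -- The parameter tanh s is the point of the radius at Poincaré distance s from 0.
      have hτ0 : 0 ≤ Real.tanh s := by
        rw [Real.tanh_eq_sinh_div_cosh]
        exact div_nonneg (Real.sinh_nonneg_iff.mpr h0) (Real.cosh_pos s).le
      have hτt : Real.tanh s ≤ t := by
        rw [← Real.artanh_le_artanh_iff ⟨by linarith, Real.tanh_lt_one s⟩ ⟨by linarith, ht1⟩,
          Real.artanh_tanh, hd]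
        exact hs
      have hτ := ofReal_mem_ball hτ0 (hτt.trans_lt ht1)
      refine ⟨ψ (Real.tanh s : ℝ), ?_, ?_⟩
      · have := DiscChain.single ψ hψ (a := 0) (by simp) hτ
        rwa [hψ0, poincareDist_zero_left, Complex.norm_real, Real.norm_of_nonneg hτ0,
          Real.artanh_tanh] at this
      · have := DiscChain.single ψ hψ hτ (ofReal_mem_ball ht0 ht1)
        rw [hψt, poincareDist_ofReal_eq_sub hτ0 hτt ht1, Real.artanh_tanh, hd] at this
        rw [show poincareDist a b + l - s = poincareDist a b - s + l by ring]
        exact this.trans h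
    · obtain ⟨y, hy1, hy2⟩ := ih (s - poincareDist a b) (by linarith) (by linarith)
      refine ⟨y, ?_, ?_⟩
      · have := DiscChain.cons φ hφ a b ha hb y _ hy1
        rwa [add_sub_cancel] at this
      · rwa [show poincareDist a b + l - s = l - (s - poincareDist a b) by ring]

theorem DiscChain.map {f : M → M} (hf : MDifferentiable 𝓘(ℂ, E) 𝓘(ℂ, E) f) {z w : M} {l : ℝ}
    (h : DiscChain E z w l) : DiscChain E (f z) (f w) l := by
  induction h with
  | nil z => exact .nil _
  | cons φ hφ a b ha hb w l h ih =>
    exact .cons (f ∘ φ) (hf.comp_mdifferentiableOn hφ) a b ha hb _ _ ih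

/-- Holomorphic self-maps do not increase the Kobayashi distance. -/
theorem kobayashiDist_map_le [IsManifold 𝓘(ℂ, E) ω M] [ConnectedSpace M] {f : M → M}
    (hf : MDifferentiable 𝓘(ℂ, E) 𝓘(ℂ, E) f) (z w : M) :
    kobayashiDist E (f z) (f w) ≤ kobayashiDist E z w := by
  refine le_csInf (DiscChain.exists (E := E) z w) fun l hl => ?_
  exact kobayashiDist_le_of_discChain (DiscChain.map hf hl)

/-- An affine disc in a chart reaches w at parameter tanh ε as soon as w is close enough to m for
the disc to fit in the chart. This makes k continuous for the manifold topology. -/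
theorem DiscChain.eventually_exists_le [IsManifold 𝓘(ℂ, E) ω M] (m : M) {ε : ℝ} (hε : 0 < ε) :
    ∀ᶠ w in 𝓝 m, DiscChain E m w ε := by
  have hop : IsOpen (chartAt E m).target := (chartAt E m).open_target
  have hm : chartAt E m m ∈ (chartAt E m).target := mem_chart_target E m
  obtain ⟨r, hr, hball⟩ := Metric.isOpen_iff.mp hop _ hm
  have hcont : ContinuousAt (chartAt E m) m := (chartAt E m).continuousAt (mem_chart_source E m)
  set t := Real.tanh ε with ht
  have ht0 : 0 < t := by
    rw [ht, Real.tanh_eq_sinh_div_cosh]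
    exact div_pos (Real.sinh_pos_iff.mpr hε) (Real.cosh_pos ε)
  have ht1 : t < 1 := Real.tanh_lt_one ε
  filter_upwards [hcont.preimage_mem_nhds (Metric.ball_mem_nhds _ (mul_pos ht0 hr)),
    (chartAt E m).open_source.mem_nhds (mem_chart_source E m)] with w hw hws
  set v : E := chartAt E m w - chartAt E m m with hv
  have hvt : ‖v‖ < t * r := by
    have : chartAt E m w ∈ Metric.ball (chartAt E m m) (t * r) := hw
    rwa [Metric.mem_ball, dist_eq_norm] at this
  let g : ℂ → E := fun ζ => chartAt E m m + (ζ / (t : ℂ)) • v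
  let φ : ℂ → M := fun ζ => (chartAt E m).symm (g ζ)
  have hmaps : MapsTo g (Metric.ball 0 1) (chartAt E m).target := by
    intro ζ hζ
    apply hball
    have hζ' : ‖ζ‖ < 1 := by simpa using hζ
    have h1 : ‖ζ‖ * ‖v‖ < t * r :=
      lt_of_le_of_lt (mul_le_of_le_one_left (norm_nonneg _) hζ'.le) hvt
    simp only [g, Metric.mem_ball, dist_eq_norm, add_sub_cancel_left, norm_smul, norm_div,
      Complex.norm_real, Real.norm_eq_abs, abs_of_pos ht0]
    rw [div_mul_eq_mul_div, div_lt_iff₀ ht0]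
    linarith
  have hg : Differentiable ℂ g := by
    intro ζ
    simp only [g]
    fun_prop
  have hφ : MDifferentiableOn 𝓘(ℂ, ℂ) 𝓘(ℂ, E) φ (Metric.ball 0 1) := by
    have h1 : MDifferentiableOn 𝓘(ℂ, E) 𝓘(ℂ, E) (chartAt E m).symm (chartAt E m).target :=
      (contMDiffOn_chart_symm (I := 𝓘(ℂ, E)) (n := ω) (x := m)).mdifferentiableOn (by simp)
    exact h1.comp hg.mdifferentiable.mdifferentiableOn hmaps
  have h0 : φ 0 = m := by
    simp [φ, g, (chartAt E m).left_inv (mem_chart_source E m)]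
  have h1 : φ (t : ℂ) = w := by
    have : (t : ℂ) ≠ 0 := by exact_mod_cast ht0.ne'
    simp [φ, g, this, hv, (chartAt E m).left_inv hws]
  have := DiscChain.single φ hφ (a := 0) (b := (t : ℂ)) (by simp) (ofReal_mem_ball ht0.le ht1)
  rwa [h0, h1, poincareDist_zero_left, Complex.norm_real, Real.norm_of_nonneg ht0.le, ht,
    Real.artanh_tanh] at this

variable [IsManifold 𝓘(ℂ, E) ω M] [ConnectedSpace M]

theorem dist_toKob (z w : M) : dist (toKob E z) (toKob E w) = kobayashiDist E z w := rfl

theorem continuous_toKob : Continuous (toKob E : M → KobayashiSpace E M) := by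
  rw [continuous_iff_continuousAt]
  intro m
  refine Metric.tendsto_nhds.mpr fun ε hε => ?_
  filter_upwards [DiscChain.eventually_exists_le (E := E) m (half_pos hε)] with w hw
  rw [dist_comm, dist_toKob]
  exact (kobayashiDist_le_of_discChain hw).trans_lt (half_lt_self hε)

/-- A chain of length below `l` can be cut anywhere. The points are only approximate because the
infimum over chains need not be attained. -/
theorem hasApproxIntermediatePoints_kobayashiSpace :
    HasApproxIntermediatePoints (KobayashiSpace E M) := by
  intro x y l s hl hs hsl
  obtain ⟨l', hl', hc⟩ := exists_discChain_lt (E := E) (z := (toKob E).symm x)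
    (w := (toKob E).symm y) hl
  rcases le_total s l' with h | h
  · obtain ⟨z, hz1, hz2⟩ := hc.exists_intermediate s hs h
    exact ⟨toKob E z, kobayashiDist_le_of_discChain hz1,
      (kobayashiDist_le_of_discChain hz2).trans (by linarith)⟩
  · exact ⟨y, (kobayashiDist_le_of_discChain hc).trans h, by simpa using hsl⟩

/-- On a hyperbolic manifold the Kobayashi distance induces the manifold topology. -/
theorem continuous_toKob_symm [T2Space M] [LocallyCompactSpace M]
    (h : IsKobayashiHyperbolic E M) : Continuous ((toKob E).symm : KobayashiSpace E M → M) := by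
  rw [continuous_iff_continuousAt]
  intro x
  obtain ⟨m, rfl⟩ := (toKob E).surjective x
  intro U hU
  rw [Equiv.symm_apply_apply] at hU
  obtain ⟨L, hLn, hLU, hLc⟩ := local_compact_nhds hU
  have hfc : IsCompact (frontier L) :=
    hLc.of_isClosed_subset isClosed_frontier hLc.isClosed.frontier_subset
  -- Compactness and hyperbolicity keep the frontier away from m, so a chain shorter than δ cannot
  -- leave L. If the frontier is empty, any δ serves.
  have hmem : ∃ δ > 0, ∀ s ∈ frontier L, δ ≤ kobayashiDist E m s := by
    rcases (frontier L).eq_empty_or_nonempty with he | hne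
    · exact ⟨1, one_pos, by simp [he]⟩
    obtain ⟨s₀, hs₀, hmin⟩ := hfc.exists_isMinOn hne
      (f := fun s => dist (toKob E m) (toKob E s))
      (continuous_const.dist continuous_toKob).continuousOn
    refine ⟨dist (toKob E m) (toKob E s₀), ?_, fun s hs => hmin hs⟩
    refine lt_of_le_of_ne dist_nonneg fun h0 => ?_
    rw [← h m s₀ h0.symm] at hs₀
    exact hs₀.2 (mem_interior_iff_mem_nhds.mpr hLn)
  obtain ⟨δ, hδ, hmin⟩ := hmem
  refine mem_map.mpr (mem_of_superset (Metric.ball_mem_nhds _ hδ) fun y hy => ?_)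
  obtain ⟨w, rfl⟩ := (toKob E).surjective y
  rw [Metric.mem_ball, dist_comm, dist_toKob] at hy
  rw [mem_preimage, Equiv.symm_apply_apply]
  by_contra hw
  obtain ⟨l, hl, hc⟩ := exists_discChain_lt hy
  obtain ⟨S, hS, hmS, hwS, hSl⟩ := hc.exists_isPreconnected
  obtain ⟨s, hsS, hsL⟩ := hS.exists_mem_frontier
    ⟨m, hmS, mem_of_mem_nhds hLn⟩ ⟨w, hwS, fun h => hw (hLU h)⟩
  obtain ⟨l', hl', hc'⟩ := hSl s hsS
  linarith [hmin s hsL, kobayashiDist_le_of_discChain hc']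

end Kobayashi

/-! ### Convergence in the end compactification -/

namespace EndCompactification

variable {C : Type*} [TopologicalSpace C] {K : CompactExhaustion C}

theorem pt_injective : Function.Injective (pt : C → EndCompactification K) := fun a b h => by
  injection h

/-- Only this inequality comes for free: components need not be open, so a basic set at an end is
not evidently a neighbourhood of it in the resulting topology. -/
theorem nhdSystem_le_nhds (x : EndCompactification K) : nhdSystem x ≤ 𝓝 x :=
  (nhds_basis_opens x).ge_iff.2 fun _ hU => hU.2 x hU.1

theorem isOpen_image_pt {U : Set C} (hU : IsOpen U) :
    IsOpen (pt '' U : Set (EndCompactification K)) := by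
  rintro _ ⟨y, hy, rfl⟩
  exact image_mem_map (hU.mem_nhds hy)

theorem tendsto_pt_iff {α : Type*} {l : Filter α} {u : α → C} {y : C} :
    Tendsto (fun n => (pt (u n) : EndCompactification K)) l (𝓝 (pt y)) ↔ Tendsto u l (𝓝 y) := by
  constructor
  · intro h
    refine (nhds_basis_opens y).tendsto_right_iff.2 fun U hU => ?_
    filter_upwards [h ((isOpen_image_pt hU.2).mem_nhds (mem_image_of_mem pt hU.1))] with n hn
    obtain ⟨y', hy', h'⟩ := hn
    rwa [← pt_injective h']
  · intro h
    exact (tendsto_map.comp h).mono_right (nhdSystem_le_nhds (pt y))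

theorem tendsto_atEnd {α : Type*} {l : Filter α} {u : α → C} {e : SpaceEnd K}
    (h : ∀ j, ∀ᶠ n in l, u n ∈ e.comp j) :
    Tendsto (fun n => (pt (u n) : EndCompactification K)) l (𝓝 (atEnd e)) := by
  refine Tendsto.mono_right ?_ (nhdSystem_le_nhds (atEnd e))
  refine tendsto_iInf.2 fun j => tendsto_principal.2 ?_
  filter_upwards [h j] with n hn
  exact Or.inl (mem_image_of_mem pt hn)

theorem comp_subset_compl (e : SpaceEnd K) (j : ℕ) : e.comp j ⊆ (K j)ᶜ := by
  obtain ⟨y, -, hy⟩ := e.isComponent j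
  rw [hy]
  exact connectedComponentIn_subset _ _

/-- A closed set that misses some component of `e` is disjoint from an open neighbourhood of `e`.
Components of the complements of the `K j` need not be open, so this is not immediate. -/
theorem exists_isOpen_atEnd_of_disjoint {A : Set C} (hA : IsClosed A) {e : SpaceEnd K} {j : ℕ}
    (hj : Disjoint (e.comp j) A) :
    ∃ U : Set (EndCompactification K), IsOpen U ∧ atEnd e ∈ U ∧ ∀ y ∈ A, pt y ∉ U := by
  refine ⟨pt '' Aᶜ ∪ atEnd '' {e' | ∃ i, Disjoint (e'.comp i) A}, ?_,
    Or.inr ⟨e, ⟨j, hj⟩, rfl⟩, ?_⟩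
  · rintro x (⟨y, hy, rfl⟩ | ⟨e', ⟨i, hi⟩, rfl⟩)
    · exact mem_of_superset (image_mem_map (hA.isOpen_compl.mem_nhds hy)) subset_union_left
    · refine mem_of_superset (mem_iInf_of_mem i (mem_principal_self (basicNhd e' i))) ?_
      rintro x (⟨y, hy, rfl⟩ | ⟨e'', h'', rfl⟩)
      · exact Or.inl ⟨y, hi.notMem_of_mem_left hy, rfl⟩
      · exact Or.inr ⟨e'', ⟨i, by rwa [h'' i le_rfl]⟩, rfl⟩
  · rintro y hy (⟨y', hy', h⟩ | ⟨e', -, h⟩)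
    · rw [pt_injective h] at hy'
      exact hy' hy
    · cases h

theorem eventually_notMem_of_tendsto_atEnd [T2Space C] {α : Type*} {l : Filter α} {u : α → C}
    {e : SpaceEnd K}
    (h : Tendsto (fun n => (pt (u n) : EndCompactification K)) l (𝓝 (atEnd e))) (j : ℕ) :
    ∀ᶠ n in l, u n ∉ K j := by
  obtain ⟨U, hU, heU, hUj⟩ := exists_isOpen_atEnd_of_disjoint (K.isCompact j).isClosed
    (e := e) (disjoint_compl_left.mono_left (comp_subset_compl e j))
  filter_upwards [h (hU.mem_nhds heU)] with n hn hK
  exact hUj _ hK hn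

/-- The points of a sequence that leaves all the `K j` form a closed set. -/
theorem isClosed_image_of_eventually_notMem [T2Space C] {u : ℕ → C}
    (h : ∀ j, ∀ᶠ n in atTop, u n ∉ K j) (s : Set ℕ) : IsClosed (u '' s) := by
  rw [← isOpen_compl_iff, isOpen_iff_mem_nhds]
  intro y hy
  obtain ⟨j, hj⟩ := K.exists_mem_nhds y
  obtain ⟨N, hN⟩ := eventually_atTop.mp (h j)
  have hfin : (u '' (s ∩ Iio N)).Finite := ((finite_Iio N).subset inter_subset_right).image u
  have hy' : y ∉ u '' (s ∩ Iio N) := fun hh => hy (image_mono inter_subset_left hh)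
  filter_upwards [hj, hfin.isClosed.isOpen_compl.mem_nhds hy'] with z hz1 hz2
  rintro ⟨n, hn, rfl⟩
  refine hz2 ⟨n, ⟨hn, ?_⟩, rfl⟩
  by_contra hle
  exact hN n (not_lt.mp hle) hz1

/-- A converse to `tendsto_atEnd` for sequences. Since u leaves every compact set, its terms outside
`e.comp j` form a closed set, which can be removed from a neighbourhood of e; openness of `e.comp j`
is not needed. -/
theorem eventually_mem_comp_of_tendsto_atEnd [T2Space C] {u : ℕ → C} {e : SpaceEnd K}
    (h : Tendsto (fun n => (pt (u n) : EndCompactification K)) atTop (𝓝 (atEnd e))) (j : ℕ) :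
    ∀ᶠ n in atTop, u n ∈ e.comp j := by
  obtain ⟨U, hU, heU, hUj⟩ := exists_isOpen_atEnd_of_disjoint (e := e) (j := j)
    (isClosed_image_of_eventually_notMem (eventually_notMem_of_tendsto_atEnd h)
      {n | u n ∉ e.comp j}) (by
        rw [disjoint_right]
        rintro _ ⟨n, hn, rfl⟩
        exact hn)
  filter_upwards [h (hU.mem_nhds heU)] with n hn
  by_contra hn'
  exact hUj _ (mem_image_of_mem u hn') hn

end EndCompactification

/-! ### Complete hyperbolic manifolds -/

section Kobayashi

variable {E : Type*} [NormedAddCommGroup E] [NormedSpace ℂ E]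
  {M : Type*} [TopologicalSpace M] [ChartedSpace E M] [IsManifold 𝓘(ℂ, E) ω M] [ConnectedSpace M]

theorem kobayashiDist_comm (z w : M) : kobayashiDist E z w = kobayashiDist E w z :=
  dist_comm (toKob E z) (toKob E w)

theorem kobayashiDist_triangle (x y z : M) :
    kobayashiDist E x z ≤ kobayashiDist E x y + kobayashiDist E y z :=
  dist_triangle (toKob E x) (toKob E y) (toKob E z)

theorem continuous_kobayashiDist (p : M) : Continuous fun z => kobayashiDist E p z :=
  continuous_const.dist (continuous_toKob (E := E))

/-- A hyperbolic manifold is homeomorphic to its Kobayashi metric space. -/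
def kobayashiHomeomorph [T2Space M] [LocallyCompactSpace M] (h : IsKobayashiHyperbolic E M) :
    M ≃ₜ KobayashiSpace E M where
  toEquiv := toKob E
  continuous_toFun := continuous_toKob
  continuous_invFun := continuous_toKob_symm h

theorem IsCompleteKobayashiHyperbolic.properSpace [T2Space M] [LocallyCompactSpace M]
    (h : IsCompleteKobayashiHyperbolic E M) : ProperSpace (KobayashiSpace E M) := by
  have := h.2
  have : LocallyCompactSpace (KobayashiSpace E M) :=
    (kobayashiHomeomorph h.1).symm.isClosedEmbedding.locallyCompactSpace
  exact hasApproxIntermediatePoints_kobayashiSpace.properSpace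

/-- Properness makes closed Kobayashi balls compact in M, so the images of p eventually leave each
of them. -/
theorem CompactlyDivergent.tendsto_kobayashiDist [T2Space M] [LocallyCompactSpace M]
    (h : IsCompleteKobayashiHyperbolic E M) {g : ℕ → M → M} (hg : CompactlyDivergent g) (p : M) :
    Tendsto (fun n => kobayashiDist E p (g n p)) atTop atTop := by
  have := h.properSpace
  refine tendsto_atTop.mpr fun r => ?_
  filter_upwards [hg {p} _ isCompact_singleton
    ((isCompact_closedBall (toKob E p) r).image (continuous_toKob_symm h.1))] with n hn
  by_contra! hlt
  refine disjoint_left.mp hn (mem_image_of_mem _ rfl) ⟨toKob E (g n p), ?_, by simp⟩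
  rw [Metric.mem_closedBall, dist_comm, dist_toKob]
  exact hlt.le

theorem tendsto_kobayashiDist_of_bounded {p : M} {a b : ℕ → M} {B : ℝ}
    (ha : Tendsto (fun n => kobayashiDist E p (a n)) atTop atTop)
    (hab : ∀ n, kobayashiDist E (a n) (b n) ≤ B) :
    Tendsto (fun n => kobayashiDist E p (b n)) atTop atTop := by
  refine tendsto_atTop_mono (fun n => ?_) (tendsto_atTop_add_const_right _ (-B) ha)
  have h1 := kobayashiDist_triangle (E := E) p (b n) (a n)
  rw [kobayashiDist_comm (b n) (a n)] at h1
  linarith [hab n]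

theorem exists_isPreconnected_kobayashiDist_le {z w : M} {B : ℝ} (h : kobayashiDist E z w ≤ B) :
    ∃ S : Set M, IsPreconnected S ∧ z ∈ S ∧ w ∈ S ∧ ∀ s ∈ S, kobayashiDist E z s ≤ B + 1 := by
  -- The extra 1 gives room for a chain, as the infimum may not be attained.
  obtain ⟨l, hl, hc⟩ := exists_discChain_lt (show kobayashiDist E z w < B + 1 by linarith)
  obtain ⟨S, hS, hz, hw, hSl⟩ := hc.exists_isPreconnected
  refine ⟨S, hS, hz, hw, fun s hs => ?_⟩
  obtain ⟨l', hl', hc'⟩ := hSl s hs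
  linarith [kobayashiDist_le_of_discChain hc']

theorem kobayashiDist_iterate_le {f : M → M} (hf : MDifferentiable 𝓘(ℂ, E) 𝓘(ℂ, E) f) (n : ℕ)
    (z w : M) : kobayashiDist E (f^[n] z) (f^[n] w) ≤ kobayashiDist E z w := by
  induction n with
  | zero => exact le_rfl
  | succ n ih =>
    rw [Function.iterate_succ_apply', Function.iterate_succ_apply']
    exact (kobayashiDist_map_le hf _ _).trans ih

end Kobayashi

/-! ### Sequences at bounded Kobayashi distance -/

section Domain

variable {E : Type*} [NormedAddCommGroup E] [NormedSpace ℂ E]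
  {X : Type*} [TopologicalSpace X] [ChartedSpace E X] [IsManifold 𝓘(ℂ, E) ω X]
  {Ω : Opens X} [ConnectedSpace Ω]

theorem notMem_of_tendsto_of_kobayashiDist_atTop {p : Ω} {a : ℕ → Ω} {a' : X}
    (ha : Tendsto (fun n => (a n : X)) atTop (𝓝 a'))
    (hpa : Tendsto (fun n => kobayashiDist E p (a n)) atTop atTop) : a' ∉ Ω := by
  intro hmem
  have h1 : Tendsto a atTop (𝓝 (⟨a', hmem⟩ : Ω)) := tendsto_subtype_rng.mpr ha
  exact not_tendsto_nhds_of_tendsto_atTop hpa _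
    (((continuous_kobayashiDist (E := E) p).tendsto _).comp h1)

theorem mem_frontier_of_tendsto_of_kobayashiDist_atTop {p : Ω} {a : ℕ → Ω} {a' : X}
    (ha : Tendsto (fun n => (a n : X)) atTop (𝓝 a'))
    (hpa : Tendsto (fun n => kobayashiDist E p (a n)) atTop atTop) :
    a' ∈ frontier (Ω : Set X) := by
  rw [Ω.isOpen.frontier_eq]
  exact ⟨mem_closure_of_tendsto ha (Eventually.of_forall fun n => (a n).2),
    notMem_of_tendsto_of_kobayashiDist_atTop ha hpa⟩

/-- Both limits lie on the frontier, since distances from p blow up; were they distinct, `hdiv`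
would contradict the bound B. -/
theorem eq_of_tendsto_of_kobayashiDist_le (hdiv : KobayashiDivergesAtBoundary E Ω) {p : Ω}
    {a b : ℕ → Ω} {B : ℝ} (hab : ∀ n, kobayashiDist E (a n) (b n) ≤ B)
    (hpa : Tendsto (fun n => kobayashiDist E p (a n)) atTop atTop) {a' b' : X}
    (ha : Tendsto (fun n => (a n : X)) atTop (𝓝 a'))
    (hb : Tendsto (fun n => (b n : X)) atTop (𝓝 b')) : a' = b' := by
  by_contra hne
  have hpb := tendsto_kobayashiDist_of_bounded hpa hab
  have h := hdiv a' (mem_frontier_of_tendsto_of_kobayashiDist_atTop ha hpa) b'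
    (mem_frontier_of_tendsto_of_kobayashiDist_atTop hb hpb) hne
  have hseq : Tendsto (fun n => (a n, b n)) atTop
      (comap (fun q : Ω × Ω => ((q.1 : X), (q.2 : X))) (𝓝 (a', b'))) :=
    tendsto_comap_iff.mpr (ha.prodMk_nhds hb)
  obtain ⟨n, hn⟩ := ((h.comp hseq).eventually_gt_atTop B).exists
  exact (hab n).not_gt hn

/-- A sequence at bounded Kobayashi distance from a sequence tending to a boundary point of the
end compactification tends to the same point. -/
theorem tendsto_toEnd_of_kobayashiDist_le [T2Space X] [SecondCountableTopology X]
    (K : CompactExhaustion (closure (Ω : Set X))) (hdiv : KobayashiDivergesAtBoundary E Ω)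
    {p : Ω} {u v : ℕ → Ω} {B : ℝ} (huv : ∀ n, kobayashiDist E (u n) (v n) ≤ B)
    (hpu : Tendsto (fun n => kobayashiDist E p (u n)) atTop atTop)
    {x : EndCompactification K} (hx : Tendsto (fun n => toEnd K (u n)) atTop (𝓝 x)) :
    Tendsto (fun n => toEnd K (v n)) atTop (𝓝 x) := by
  let ι : Ω → closure (Ω : Set X) := fun z => ⟨z, subset_closure z.2⟩
  have hι : Continuous ι := continuous_subtype_val.subtype_mk _
  have hcoe : ∀ {a : ℕ → Ω} {a' : closure (Ω : Set X)}, Tendsto (fun n => ι (a n)) atTop (𝓝 a') →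
      Tendsto (fun n => (a n : X)) atTop (𝓝 (a' : X)) := fun h =>
    (continuous_subtype_val.tendsto _).comp h
  choose S hS huS hvS hSB using fun n => exists_isPreconnected_kobayashiDist_le (huv n)
  have hιS : ∀ n, IsPreconnected (ι '' S n) := fun n => (hS n).image ι hι.continuousOn
  cases x with
  | pt y =>
    have huy : Tendsto (fun n => ι (u n)) atTop (𝓝 y) := EndCompactification.tendsto_pt_iff.mp hx
    refine EndCompactification.tendsto_pt_iff.mpr ?_
    -- If v is frequently outside U, the connected sets `S n` cross the compact frontier of a
    -- smaller neighbourhood L of y. A limit of crossing points must equal y, which is interior to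
    -- L.
    intro U hU
    by_contra hcon
    have : WeaklyLocallyCompactSpace (closure (Ω : Set X)) :=
      ⟨fun z => (K.exists_mem_nhds z).imp' K fun j hj => ⟨K.isCompact j, hj⟩⟩
    obtain ⟨L, hLn, hLU, hLc⟩ := local_compact_nhds hU
    have hfreq : ∃ᶠ n in atTop, ∃ s ∈ S n, ι s ∈ frontier L := by
      have hv : ∃ᶠ n in atTop, ι (v n) ∉ U := fun h => hcon (h.mono fun n hn => not_not.mp hn)
      refine (hv.and_eventually (huy hLn)).mono fun n hn => ?_
      obtain ⟨_, ⟨s, hs, rfl⟩, hsL⟩ := (hιS n).exists_mem_frontier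
        ⟨_, mem_image_of_mem ι (huS n), hn.2⟩
        ⟨_, mem_image_of_mem ι (hvS n), fun h => hn.1 (hLU h)⟩
      exact ⟨s, hs, hsL⟩
    obtain ⟨φ, hφ, hs⟩ := extraction_of_frequently_atTop hfreq
    choose s hsS hsL using hs
    have hfc : IsCompact (frontier L) :=
      hLc.of_isClosed_subset isClosed_frontier hLc.isClosed.frontier_subset
    obtain ⟨s', hs', ψ, hψ, hlim⟩ := hfc.tendsto_subseq hsL
    have hφψ := hφ.tendsto_atTop.comp hψ.tendsto_atTop
    have heq := eq_of_tendsto_of_kobayashiDist_le hdiv (a := u ∘ φ ∘ ψ) (b := s ∘ ψ) (B := B + 1)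
      (fun n => hSB _ _ (hsS (ψ n))) (hpu.comp hφψ) (hcoe (huy.comp hφψ)) (hcoe hlim)
    rw [← Subtype.ext heq] at hs'
    exact hs'.2 (mem_interior_iff_mem_nhds.mpr hLn)
  | atEnd e =>
    refine EndCompactification.tendsto_atEnd fun j => ?_
    -- Here u has no limit to compare with, so two crossings are compared instead: their limits lie
    -- on the frontiers of `K j` and `K (j + 1)`, which are disjoint, yet they must coincide.
    by_contra hcon
    have hue := EndCompactification.eventually_mem_comp_of_tendsto_atEnd hx
    have hfreq : ∃ᶠ n in atTop, ∃ s ∈ S n, ∃ t ∈ S n,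
        ι s ∈ frontier (K j) ∧ ι t ∈ frontier (K (j + 1)) := by
      have hv : ∃ᶠ n in atTop, ι (v n) ∉ e.comp j :=
        fun h => hcon (h.mono fun n hn => not_not.mp hn)
      refine (hv.and_eventually ((hue j).and (hue (j + 1)))).mono ?_
      rintro n ⟨hvn, hun : ι (u n) ∈ e.comp j, hun' : ι (u n) ∈ e.comp (j + 1)⟩
      -- A connected set through `u n` avoiding `K j` would stay in the component `e.comp j` and so
      -- contain no `v n` outside it.
      have hmeet : (ι '' S n ∩ K j).Nonempty := by
        by_contra hempty
        obtain ⟨y, hy, hcomp⟩ := e.isComponent j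
        rw [hcomp] at hun hvn
        rw [connectedComponentIn_eq hun] at hvn
        exact hvn ((hιS n).subset_connectedComponentIn (mem_image_of_mem ι (huS n))
          (fun z hz hzK => hempty ⟨z, hz, hzK⟩) (mem_image_of_mem ι (hvS n)))
      obtain ⟨_, ⟨s, hs, rfl⟩, hsK⟩ := (hιS n).exists_mem_frontier hmeet
        ⟨_, mem_image_of_mem ι (huS n), EndCompactification.comp_subset_compl e j hun⟩
      obtain ⟨_, ⟨t, ht, rfl⟩, htK⟩ := (hιS n).exists_mem_frontier
        (hmeet.mono (inter_subset_inter_right _ (K.subset_succ j)))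
        ⟨_, mem_image_of_mem ι (huS n), EndCompactification.comp_subset_compl e (j + 1) hun'⟩
      exact ⟨s, hs, t, ht, hsK, htK⟩
    obtain ⟨φ, hφ, hst⟩ := extraction_of_frequently_atTop hfreq
    choose s hsS t htS hsK htK using hst
    have hfc : ∀ i, IsCompact (frontier (K i)) := fun i =>
      (K.isCompact i).of_isClosed_subset isClosed_frontier (K.isCompact i).isClosed.frontier_subset
    obtain ⟨s', hs', ψ, hψ, hlims⟩ := (hfc j).tendsto_subseq hsK
    obtain ⟨t', ht', χ, hχ, hlimt⟩ := (hfc (j + 1)).tendsto_subseq fun n => htK (ψ n)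
    have hps : Tendsto (fun n => kobayashiDist E p (s (ψ (χ n)))) atTop atTop :=
      tendsto_kobayashiDist_of_bounded
        (hpu.comp (hφ.tendsto_atTop.comp (hψ.tendsto_atTop.comp hχ.tendsto_atTop)))
        fun n => hSB _ _ (hsS (ψ (χ n)))
    have heq := eq_of_tendsto_of_kobayashiDist_le hdiv (a := s ∘ ψ ∘ χ) (b := t ∘ ψ ∘ χ)
      (B := (B + 1) + (B + 1)) (fun n => by
        refine (kobayashiDist_triangle _ (u (φ (ψ (χ n)))) _).trans (add_le_add ?_ ?_)
        · rw [kobayashiDist_comm]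
          exact hSB _ _ (hsS (ψ (χ n)))
        · exact hSB _ _ (htS (ψ (χ n))))
      hps (hcoe (hlims.comp hχ.tendsto_atTop)) (hcoe hlimt)
    rw [← Subtype.ext heq] at ht'
    exact ht'.2 (K.subset_interior_succ j ((K.isCompact j).isClosed.frontier_subset hs'))

end Domain

/-! ### Choice of times, liminf comparison, and the theorem -/

/-- A real sequence tending to infinity attains, infinitely often, a value that it never goes
below afterwards. -/
theorem exists_strictMono_forall_le_add {a : ℕ → ℝ} (ha : Tendsto a atTop atTop) :
    ∃ m : ℕ → ℕ, StrictMono m ∧ ∀ k i, a (m k) ≤ a (m k + i) := by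
  have hfreq : ∃ᶠ n in atTop, ∀ i, a n ≤ a (n + i) := by
    refine frequently_atTop.mpr fun N => ?_
    have hN : Tendsto (fun i => a (N + i)) cofinite atTop := by
      rw [Nat.cofinite_eq_atTop]
      exact ha.comp (tendsto_atTop_mono (fun i => Nat.le_add_left i N) tendsto_id)
    -- A minimum of the tail starting at N is such a value.
    obtain ⟨i₀, hi₀⟩ := hN.exists_forall_le
    exact ⟨N + i₀, Nat.le_add_right _ _, fun i => by
      rw [add_assoc]
      exact hi₀ (i₀ + i)⟩
  exact extraction_of_frequently_atTop hfreq

/-- Only an upper bound along v converges in the application; the differences evaluated at fʲ(u)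
need not. -/
theorem liminf_le_of_tendsto_of_comp_le {α β : Type*} {l : Filter α} [NeBot l] {l' : Filter β}
    {v : α → β} (hv : Tendsto v l l') {g : β → EReal} {c : α → EReal} {L : EReal}
    (hc : Tendsto c l (𝓝 L)) (h : ∀ a, g (v a) ≤ c a) : liminf g l' ≤ L := by
  rw [← hc.liminf_eq]
  calc liminf g l' ≤ liminf g (map v l) := liminf_le_liminf_of_le hv
    _ = liminf (g ∘ v) l := (liminf_comp g v l).symm
    _ ≤ liminf c l := liminf_le_liminf (Eventually.of_forall h)

theorem le_limsup_of_tendsto_comp {α β : Type*} {l : Filter α} [NeBot l] {l' : Filter β}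
    {v : α → β} (hv : Tendsto v l l') {g : β → EReal} {L : EReal}
    (hc : Tendsto (g ∘ v) l (𝓝 L)) : L ≤ limsup g l' := by
  rw [← hc.limsup_eq, limsup_comp]
  exact limsup_le_limsup_of_le hv

theorem theorem1p4 {E : Type*} [NormedAddCommGroup E] [NormedSpace ℂ E] [FiniteDimensional ℂ E]
    {X : Type*} [TopologicalSpace X] [T2Space X] [SecondCountableTopology X] [ChartedSpace E X]
    [IsManifold 𝓘(ℂ, E) ω X]
    (Ω : TopologicalSpace.Opens X) [ConnectedSpace Ω] (hΩ : (Ω : Set X) ≠ Set.univ)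
    (K : CompactExhaustion (closure (Ω : Set X))) (hK : SeqCompactSpace (EndCompactification K))
    (hcomplete : IsCompleteKobayashiHyperbolic E Ω)
    (hdiv : KobayashiDivergesAtBoundary E Ω)
    (f : Ω → Ω) (hf : MDifferentiable 𝓘(ℂ, E) 𝓘(ℂ, E) f)
    (hfdiv : CompactlyDivergent fun n => f^[n]) (p : Ω) :
    ∃ x ∈ endBoundary K, ∃ ξ ∈ metricFiber E K x,
      (∀ (n : ℕ) (R : ℝ), 0 < R →
        f^[n] '' kobayashiHoroball E p ξ R ⊆ bigHorosphere E K p x R) ∧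
      (∀ (n : ℕ) (R : ℝ), 0 < R →
        f^[n] '' smallHorosphere E K p x R ⊆ bigHorosphere E K p x R) := by
  have : ProperSpace E := FiniteDimensional.proper ℂ E
  have : LocallyCompactSpace X := ChartedSpace.locallyCompactSpace E X
  have : LocallyCompactSpace Ω := Ω.isOpen.locallyCompactSpace
  have := hcomplete.properSpace
  have ha := hfdiv.tendsto_kobayashiDist hcomplete p
  obtain ⟨m, hm, hmin⟩ := exists_strictMono_forall_le_add ha
  obtain ⟨x, φ, hφ, hx⟩ := SeqCompactSpace.tendsto_subseq fun n => toEnd K (f^[m n] p)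
  have hu₀ : Tendsto (fun n => kobayashiDist E p (f^[m (φ n)] p)) atTop atTop :=
    ha.comp (hm.tendsto_atTop.comp hφ.tendsto_atTop)
  obtain ⟨ξ, hξ, ψ, hψ, hemb, hlim⟩ := MetricCompactification.exists_subseq_tendsto_boundary
    hasApproxIntermediatePoints_kobayashiSpace (p := toKob E p)
    (u := fun n => toKob E (f^[m (φ n)] p)) hu₀
  set u : ℕ → Ω := fun n => f^[m (φ (ψ n))] p with hu
  have hpu : Tendsto (fun n => kobayashiDist E p (u n)) atTop atTop := hu₀.comp hψ.tendsto_atTop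
  have hxu : Tendsto (fun n => toEnd K (u n)) atTop (𝓝 x) := hx.comp hψ.tendsto_atTop
  have hlim' : ∀ z : Ω, Tendsto (fun n => kobayashiDist E z (u n) - kobayashiDist E p (u n)) atTop
      (𝓝 (MetricCompactification.horofunction (toKob E p) ξ (toKob E z))) := by
    intro z
    refine (hlim (toKob E z)).congr fun n => ?_
    rw [dist_toKob, dist_toKob, kobayashiDist_comm, kobayashiDist_comm _ p]
  have hhoro : ∀ (n : ℕ) (R : ℝ), 0 < R →
      f^[n] '' kobayashiHoroball E p ξ R ⊆ bigHorosphere E K p x R := by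
    rintro j R - _ ⟨z, hz, rfl⟩
    have hz' : MetricCompactification.horofunction (toKob E p) ξ (toKob E z) <
      1 / 2 * Real.log R := hz
    have hcomm : ∀ n, f^[j] (u n) = f^[m (φ (ψ n)) + j] p := fun n => by
      rw [hu, add_comm, Function.iterate_add_apply]
    -- Iterates commute, so fʲ(u n) and u n are the images of fʲ(p) and p under the same iterate.
    have hv : Tendsto (fun n => toEnd K (f^[j] (u n))) atTop (𝓝 x) := by
      refine tendsto_toEnd_of_kobayashiDist_le K hdiv (B := kobayashiDist E p (f^[j] p))
        (fun n => ?_) hpu hxu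
      rw [hcomm, Function.iterate_add_apply]
      exact kobayashiDist_iterate_le hf _ _ _
    have hv' : Tendsto (fun n => f^[j] (u n)) atTop (comap (toEnd K) (𝓝 x)) :=
      tendsto_comap_iff.mpr hv
    refine lt_of_le_of_lt (liminf_le_of_tendsto_of_comp_le hv'
      ((continuous_coe_real_ereal.tendsto _).comp (hlim' z)) fun n => ?_)
      (EReal.coe_lt_coe_iff.mpr hz')
    refine EReal.coe_le_coe_iff.mpr ?_
    -- Contraction bounds the first term from above, and the choice of times bounds the subtracted
    -- term from below.
    have h1 := kobayashiDist_iterate_le hf j z (u n)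
    have h2 := hmin (φ (ψ n)) j
    rw [← hcomm] at h2
    exact sub_le_sub h1 h2
  refine ⟨x, ?_, ξ, ⟨hξ, u, hxu, hemb⟩, hhoro, fun n R hR => ?_⟩
  · rintro ⟨z, rfl⟩
    have hz := EndCompactification.tendsto_pt_iff (K := K)
      (u := fun n => ⟨u n, subset_closure (u n).2⟩) (y := ⟨z, subset_closure z.2⟩) |>.mp hxu
    exact notMem_of_tendsto_of_kobayashiDist_atTop
      ((continuous_subtype_val.tendsto (⟨z, subset_closure z.2⟩ : closure (Ω : Set X))).comp hz)
      hpu z.2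
  · refine (image_mono fun z hz => ?_).trans (hhoro n R hR)
    have hxu' : Tendsto u atTop (comap (toEnd K) (𝓝 x)) := tendsto_comap_iff.mpr hxu
    exact EReal.coe_lt_coe_iff.mp (lt_of_le_of_lt (le_limsup_of_tendsto_comp
      hxu' ((continuous_coe_real_ereal.tendsto _).comp (hlim' z))) hz)
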